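/- Let $\lambda$ be an uncountable cardinal with $2^{<\lambda}=\lambda$, where $2^{<\lambda}=\sup\{2^{\nu}\mid \nu<\lambda \text{ a cardinal}\}$. Then no $\lambda^+$-Borel space carries a continuous $\lambda^+$-measure. Precisely: Let $Y$ be a set and $\mathfrak M$ a family of subsets of $Y$ such that $(Y,\mathfrak M)$ is a $\lambda^+$-Borel space, i.e. $\mathfrak M$ is a $\lambda^+$-algebra (closed under unions and intersections of at most $\lambda$ members and under complements), separates the points of $Y$, and is the smallest $\lambda^+$-algebra containing some family of at most $\lambda$ sets. Let $\tau$ be any topology on $Y$ that has a basis of size at most $\lambda$ and satisfies $\tau\subseteq\mathfrak M$ (for instance, a $T_0$ topology of weight at most $\lambda$ that generates $\mathfrak M$). Let $\mathbb S=(S,0,+,\le)$ be any positively totally ordered monoid: a (not necessarily commutative) monoid with a total order such that $a\le b$ and $c\le d$ imply $a+c\le b+d$, with least element $0$, and with $S\neq\{0\}$. Let $\Sigma$ be any infinitary sum on $\mathbb S$: a partial function from the sequences of elements of $S$ of arbitrary ordinal length to $S$ such that - $\Sigma(\emptyset)=0$, and $\Sigma(s)=s_0+\dots+s_n$ for every non-empty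 finite $s=(s_i)_{i\le n}$ in $\operatorname{dom}(\Sigma)$; - for every $s\in\operatorname{dom}(\Sigma)$ of limit length $\operatorname{lh}(s)$ such that $s\restriction\alpha\in\operatorname{dom}(\Sigma)$ for cofinally many $\alpha<\operatorname{lh}(s)$, one has $\Sigma(s)=\sup\{\Sigma(s\restriction\alpha)\mid \alpha<\operatorname{lh}(s),\ s\restriction\alpha\in\operatorname{dom}(\Sigma)\}$. Then there is no partial function $\mu:\mathcal P(Y)\to S$ with $\mathfrak M\subseteq\operatorname{dom}(\mu)$ that is a continuous $\lambda^+$-measure, i.e. that satisfies all of the following: 1. $\mu(\emptyset)=0$; 2. $\mu(Y)>0$; 3. $\mu(A)\le\mu(B)$ for all $A,B\in\mathfrak M$ with $A\subseteq B$; 4. for every ordinal $\gamma<\lambda^+$ and every sequence $(A_i)_{i<\gamma}$ of pairwise disjoint members of $\mathfrak M$, the sequence $\langle\mu(A_i)\mid i<\gamma\rangle$ is in $\operatorname{dom}(\Sigma)$ and $\mu(\bigcup_{i<\gamma}A_i)=\Sigma(\langle\mu(A_i)\mid i<\gamma\rangle)$; 5. for every $x\in Y$ with $\{x\}\in\mathfrak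 M$ and every open local $\tau$-basis $\mathcal B$ at $x$ with $|\mathcal B|\le\lambda$, one has $\mu(\{x\})=\inf_{B\in\mathcal B}\mu(B)$; 6. (continuity) for every $x\in Y$, $\{x\}\in\mathfrak M$ and $\mu(\{x\})=0$. -/

import Mathlib

universe u v

open Cardinal Ordinal

/-! ### Positively totally ordered monoids and infinitary sums -/

/-- A totally ordered monoid (not necessarily commutative) whose order is weakly translation
invariant is *positively ordered* if `0` is its least element and it is not trivial. -/
class IsPositivelyOrderedMonoid (S : Type v) [AddMonoid S] [LinearOrder S] : Prop where
  add_le_add : ∀ a b c d : S, a ≤ b → c ≤ d → a + c ≤ b + d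
  zero_le : ∀ a : S, 0 ≤ a
  exists_pos : ∃ a : S, 0 < a

/-- Sequences of elements of `S` of arbitrary ordinal length. -/
structure OrdSeq (S : Type v) where
  length : Ordinal.{u}
  term : Set.Iio length → S

/-- The initial segment `s ↾ α`, for `α ≤ lh s`. -/
def OrdSeq.restrict {S : Type v} (s : OrdSeq.{u, v} S) (α : Ordinal.{u}) (h : α ≤ s.length) :
    OrdSeq.{u, v} S where
  length := α
  term i := s.term ⟨i.1, lt_of_lt_of_le i.2 h⟩

/-- An infinitary sum on `S`: a partial function on the sequences of ordinal length that is
compatible with `+` on finite sequences and continuous at limit lengths. -/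
structure InfinitarySum (S : Type v) [AddMonoid S] [LinearOrder S] where
  /-- the partial function -/
  sum : OrdSeq.{u, v} S →. S
  /-- the empty sequence has sum `0` -/
  sum_empty : ∀ s : OrdSeq.{u, v} S, s.length = 0 → (0 : S) ∈ sum s
  /-- on finite sequences in the domain the sum is `s₀ + ⋯ + sₙ₋₁`, in this order -/
  sum_finite : ∀ (s : OrdSeq.{u, v} S) (n : ℕ) (h : s.length = (n : Ordinal.{u})), ∀ a ∈ sum s,
    a = (List.ofFn fun i : Fin n => s.term ⟨(i : ℕ), by
      rw [Set.mem_Iio, h]; exact_mod_cast i.2⟩).sum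
  /-- continuity: if `s` is in the domain and has limit length, and cofinally many of its proper
  initial segments are in the domain, then its sum is the supremum of their sums -/
  sum_limit : ∀ s : OrdSeq.{u, v} S, Order.IsSuccLimit s.length → ∀ a ∈ sum s,
    (∀ β < s.length, ∃ α, ∃ h : α < s.length, β ≤ α ∧ (sum (s.restrict α h.le)).Dom) →
      IsLUB {b : S | ∃ α, ∃ h : α < s.length, b ∈ sum (s.restrict α h.le)} a

/-! ### Algebras of sets, generation, weight -/

/-- A `lam⁺`-algebra of subsets of `X`: a family closed under unions and intersections of at most
`lam` of its members, and under complements. -/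
structure IsLambdaAlgebra {X : Type u} (lam : Cardinal.{u}) (M : Set (Set X)) : Prop where
  sUnion_mem : ∀ A : Set (Set X), A ⊆ M → #A ≤ lam → ⋃₀ A ∈ M
  sInter_mem : ∀ A : Set (Set X), A ⊆ M → #A ≤ lam → ⋂₀ A ∈ M
  compl_mem : ∀ A ∈ M, Aᶜ ∈ M

/-- The smallest `lam⁺`-algebra containing `G`. -/
def generatedLambdaAlgebra {X : Type u} (lam : Cardinal.{u}) (G : Set (Set X)) : Set (Set X) :=
  ⋂₀ {N : Set (Set X) | IsLambdaAlgebra lam N ∧ G ⊆ N}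

/-- `(X, M)` is a `lam⁺`-Borel space: `M` is a `lam⁺`-algebra that separates the points of `X` and
is generated by a subfamily of size at most `lam`. -/
structure IsLambdaBorelSpace {X : Type u} (lam : Cardinal.{u}) (M : Set (Set X)) : Prop where
  isLambdaAlgebra : IsLambdaAlgebra lam M
  separates : ∀ x y : X, x ≠ y → ∃ A ∈ M, ¬ (x ∈ A ↔ y ∈ A)
  generated : ∃ G : Set (Set X), #G ≤ lam ∧ M = generatedLambdaAlgebra lam G

/-- The weight of a topological space: the least cardinality of a basis. -/
noncomputable def topologicalWeight (X : Type u) [TopologicalSpace X] : Cardinal.{u} :=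
  sInf {c | ∃ B : Set (Set X), TopologicalSpace.IsTopologicalBasis B ∧ #B = c}

/-- `B` is an (open) local basis at `x`. -/
def IsOpenLocalBasis {X : Type u} [TopologicalSpace X] (x : X) (B : Set (Set X)) : Prop :=
  (∀ U ∈ B, IsOpen U ∧ x ∈ U) ∧ ∀ V : Set X, IsOpen V → x ∈ V → ∃ U ∈ B, U ⊆ V

/-! ### Measures -/

/-- `μ` is a `lam⁺`-measure on `M` with values in `(S, Sg)`. Only the values of `μ` on members of
`M` are constrained, so a total function stands for a partial one defined at least on `M`. -/
structure IsLambdaMeasure {X : Type u} [TopologicalSpace X] (lam : Cardinal.{u})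
    (M : Set (Set X)) {S : Type v} [AddMonoid S] [LinearOrder S] (Sg : InfinitarySum.{u, v} S)
    (μ : Set X → S) : Prop where
  empty : μ ∅ = 0
  univ_pos : 0 < μ Set.univ
  mono : ∀ A ∈ M, ∀ B ∈ M, A ⊆ B → μ A ≤ μ B
  /-- additivity along pairwise disjoint sequences of ordinal length `γ < lam⁺`: the sequence of
  values is in the domain of the infinitary sum, and its sum is the measure of the union -/
  additive : ∀ γ : Ordinal.{u}, γ < (Order.succ lam).ord → ∀ A : Set.Iio γ → Set X,
    (∀ i, A i ∈ M) → (∀ i j, i ≠ j → Disjoint (A i) (A j)) →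
      μ (⋃ i, A i) ∈ Sg.sum ⟨γ, fun i => μ (A i)⟩
  /-- point-regularity -/
  point_regular : ∀ x : X, {x} ∈ M → ∀ B : Set (Set X), IsOpenLocalBasis x B → #B ≤ lam →
    IsGLB (μ '' B) (μ {x})

/-- `μ` is continuous: all singletons are measurable of measure `0`. -/
def IsContinuousMeasure {X : Type u} (M : Set (Set X)) {S : Type v} [Zero S]
    (μ : Set X → S) : Prop :=
  ∀ x : X, {x} ∈ M ∧ μ {x} = 0

/-! Null sets are closed under unions of size at most `lam`, and a set `U` with 0 < μ(U) < μ(Y)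
turns out to be null. Disjointifying, the limit axiom for sums makes the measure of a union of at
most `lam` sets the supremum over finite subunions (`iUnion_le`). Point-regularity covers Y by at
most `lam` sets of measure below any d > 0, so the multiples of d pass every c < μ(Y)
(`exists_lt_nsmul`). Since there are no atoms, positive sets split into arbitrarily many pieces;
hence a sequence d_n is coinitial in the positive elements (`exists_seq_coinitial`), and disjoint
families inside `U` have only countably many non-null members. So for each n, `U` is covered, modulo
a null set, by countably many sets f(n, k) of measure below d_n. Distributing, `U` lies in a null
set together with the sets ⋂ₙ f(n, g(n)), g : ℕ → ℕ. Each is null by coinitiality, and there are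
2^ℵ₀ ≤ `lam` of them. -/

namespace IsLambdaAlgebra

/-! ### Closure properties of the algebra -/

variable {Y : Type u} {lam : Cardinal.{u}} {M : Set (Set Y)}

theorem iUnion_mem (hM : IsLambdaAlgebra lam M) {ι : Type u} (hι : #ι ≤ lam) (A : ι → Set Y)
    (hA : ∀ i, A i ∈ M) : (⋃ i, A i) ∈ M := by
  rw [← Set.sUnion_range]
  exact hM.sUnion_mem _ (Set.range_subset_iff.2 hA) (mk_range_le.trans hι)

theorem iInter_mem (hM : IsLambdaAlgebra lam M) {ι : Type u} (hι : #ι ≤ lam) (A : ι → Set Y)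
    (hA : ∀ i, A i ∈ M) : (⋂ i, A i) ∈ M := by
  rw [← Set.sInter_range]
  exact hM.sInter_mem _ (Set.range_subset_iff.2 hA) (mk_range_le.trans hι)

theorem biUnion_mem (hM : IsLambdaAlgebra lam M) {ι : Type u} (s : Set ι) (hs : #s ≤ lam)
    (A : ι → Set Y) (hA : ∀ i ∈ s, A i ∈ M) : (⋃ i ∈ s, A i) ∈ M := by
  rw [Set.biUnion_eq_iUnion]
  exact hM.iUnion_mem hs _ fun i => hA i i.2

theorem empty_mem (hM : IsLambdaAlgebra lam M) : ∅ ∈ M := by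
  simpa using hM.sUnion_mem ∅ (Set.empty_subset _) (by simp)

theorem union_mem (hM : IsLambdaAlgebra lam M) (hlam : ℵ₀ < lam) {A B : Set Y} (hA : A ∈ M)
    (hB : B ∈ M) : A ∪ B ∈ M := by
  rw [← Set.sUnion_pair]
  refine hM.sUnion_mem _ (by rintro _ (rfl | rfl) <;> assumption) ?_
  exact (Cardinal.lt_aleph0_of_finite _).le.trans hlam.le

theorem inter_mem (hM : IsLambdaAlgebra lam M) (hlam : ℵ₀ < lam) {A B : Set Y} (hA : A ∈ M)
    (hB : B ∈ M) : A ∩ B ∈ M := by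
  rw [← Set.sInter_pair]
  refine hM.sInter_mem _ (by rintro _ (rfl | rfl) <;> assumption) ?_
  exact (Cardinal.lt_aleph0_of_finite _).le.trans hlam.le

theorem diff_mem (hM : IsLambdaAlgebra lam M) (hlam : ℵ₀ < lam) {A B : Set Y} (hA : A ∈ M)
    (hB : B ∈ M) : A \ B ∈ M :=
  hM.inter_mem hlam hA (hM.compl_mem B hB)

theorem finset_biUnion_mem (hM : IsLambdaAlgebra lam M) (hlam : ℵ₀ < lam) {ι : Type*}
    (s : Finset ι) (A : ι → Set Y) (hA : ∀ i ∈ s, A i ∈ M) : (⋃ i ∈ s, A i) ∈ M := by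
  classical
  induction s using Finset.induction_on with
  | empty => simpa using hM.empty_mem
  | insert a s _ ih =>
    rw [Finset.set_biUnion_insert]
    exact hM.union_mem hlam (hA a (by simp)) (ih fun i hi => hA i (by simp [hi]))

end IsLambdaAlgebra

theorem exists_isTopologicalBasis_of_topologicalWeight_le {Y : Type u} [TopologicalSpace Y]
    {lam : Cardinal.{u}} (h : topologicalWeight Y ≤ lam) :
    ∃ B : Set (Set Y), TopologicalSpace.IsTopologicalBasis B ∧ #B ≤ lam := by
  obtain ⟨B, hB, hc⟩ := csInf_mem (s := {c | ∃ B : Set (Set Y),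
    TopologicalSpace.IsTopologicalBasis B ∧ #B = c})
    ⟨_, _, TopologicalSpace.isTopologicalBasis_opens, rfl⟩
  exact ⟨B, hB, hc.trans_le h⟩

theorem Ordinal.card_le_of_lt_succ_ord {lam : Cardinal.{u}} {γ : Ordinal.{u}}
    (hγ : γ < (Order.succ lam).ord) : γ.card ≤ lam :=
  Order.lt_succ_iff.1 (Cardinal.lt_ord.1 hγ)

/-- A `lam⁺`-algebra is closed under unions of length `γ < lam⁺`. -/
theorem IsLambdaAlgebra.iUnion_Iio_mem {Y : Type u} {lam : Cardinal.{u}} {M : Set (Set Y)}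
    (hM : IsLambdaAlgebra lam M) {γ : Ordinal.{u}} (hγ : γ < (Order.succ lam).ord)
    (A : Ordinal.{u} → Set Y) (hA : ∀ i < γ, A i ∈ M) : (⋃ i : Set.Iio γ, A i) ∈ M := by
  have h := hM.iUnion_mem (ι := γ.ToType)
    (by rw [Cardinal.mk_toType]; exact Ordinal.card_le_of_lt_succ_ord hγ)
    (fun i => A (Ordinal.ToType.mk.symm i))
    (fun i => hA _ (Ordinal.ToType.mk.symm i).2)
  convert h using 1
  exact (Ordinal.ToType.mk.symm.surjective.iUnion_comp (fun i : Set.Iio γ => A i)).symm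

/-! ### Additivity, continuity at unions, and small covers -/

namespace IsLambdaMeasure

variable {Y : Type u} [TopologicalSpace Y] {lam : Cardinal.{u}} {M : Set (Set Y)}
  {S : Type v} [AddMonoid S] [LinearOrder S]
  {Sg : InfinitarySum.{u, v} S} {μ : Set Y → S}

theorem union_eq (hμ : IsLambdaMeasure lam M Sg μ) (hlam : ℵ₀ < lam)
    {A B : Set Y} (hA : A ∈ M) (hB : B ∈ M) (hAB : Disjoint A B) : μ (A ∪ B) = μ A + μ B := by
  have h2 : ((2 : ℕ) : Ordinal.{u}) < (Order.succ lam).ord := by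
    rw [Cardinal.lt_ord, Ordinal.card_nat]
    exact (Cardinal.natCast_lt_aleph0 (n := 2)).trans (hlam.trans (Order.lt_succ lam))
  have key := hμ.additive ((2 : ℕ) : Ordinal.{u}) h2 (fun i => if i.1 = 0 then A else B)
    (fun i => by split_ifs <;> assumption)
    (fun i j hij => by
      have hi : ∀ k : Set.Iio ((2 : ℕ) : Ordinal.{u}), k.1 ≠ 0 → k.1 = 1 := fun k hk => by
        have h : k.1 < 1 + 1 :=
          lt_of_lt_of_eq k.2 (by rw [one_add_one_eq_two, Nat.cast_two])
        exact le_antisymm (Order.lt_add_one_iff.1 h) (Order.one_le_iff_ne_zero.2 hk)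
      split_ifs with h1 h3 h3
      · exact absurd (Subtype.ext (h1.trans h3.symm)) hij
      · exact hAB
      · exact hAB.symm
      · exact absurd (Subtype.ext ((hi i h1).trans (hi j h3).symm)) hij)
  have hU : (⋃ i : Set.Iio ((2 : ℕ) : Ordinal.{u}), if i.1 = 0 then A else B) = A ∪ B := by
    ext x
    simp only [Set.mem_iUnion, Set.mem_union]
    constructor
    · rintro ⟨i, hi⟩
      split_ifs at hi
      exacts [Or.inl hi, Or.inr hi]
    · rintro (hx | hx)
      · exact ⟨⟨0, by simp⟩, by simpa using hx⟩
      · exact ⟨⟨1, by simp⟩, by simpa using hx⟩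
  rw [hU] at key
  have := Sg.sum_finite _ 2 rfl _ key
  simpa [List.ofFn_succ] using this

/-- The differences `B i` are disjoint with the same partial unions as `E`, so the limit axiom makes
the measure of the union the supremum of the measures of the earlier partial unions; the one below
`α` lies inside `E α`. -/
theorem iUnion_le_of_isSuccLimit (hμ : IsLambdaMeasure lam M Sg μ) (hM : IsLambdaAlgebra lam M)
    (hlam : ℵ₀ < lam) {γ : Ordinal.{u}} (hγ : γ < (Order.succ lam).ord) (hl : Order.IsSuccLimit γ)
    {E : Ordinal.{u} → Set Y} (hE : ∀ i, i < γ → E i ∈ M) (hmono : Monotone E) {b : S}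
    (hb : ∀ i < γ, μ (E i) ≤ b) : μ (⋃ i : Set.Iio γ, E i) ≤ b := by
  set B : Ordinal.{u} → Set Y := fun i => E i \ ⋃ j : Set.Iio i, E j with hB
  have hBM : ∀ i < γ, B i ∈ M := fun i hi =>
    hM.diff_mem hlam (hE i hi) (hM.iUnion_Iio_mem (hi.trans hγ) E fun j hj => hE j (hj.trans hi))
  have hdisj : ∀ i j, i ≠ j → Disjoint (B i) (B j) := by
    have : ∀ i j, i < j → Disjoint (B i) (B j) := fun i j hij =>
      Set.disjoint_left.2 fun x hx hx' => hx'.2 (Set.mem_iUnion.2 ⟨⟨i, hij⟩, hx.1⟩)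
    intro i j hij
    rcases lt_or_gt_of_ne hij with h | h
    exacts [this i j h, (this j i h).symm]
  have hunion : ∀ α : Ordinal.{u}, (⋃ i : Set.Iio α, B i) = ⋃ i : Set.Iio α, E i := by
    intro α
    refine subset_antisymm (Set.iUnion_mono fun i : Set.Iio α => Set.sdiff_subset) ?_
    rintro x hx
    obtain ⟨⟨i, hi⟩, hxi⟩ := Set.mem_iUnion.1 hx
    obtain ⟨k, hk, hmin⟩ := WellFounded.has_min (wellFounded_lt (α := Ordinal.{u}))
      {i | x ∈ E i} ⟨i, hxi⟩
    refine Set.mem_iUnion.2 ⟨⟨k, lt_of_le_of_lt (not_lt.1 (hmin i hxi)) hi⟩, hk, fun h => ?_⟩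
    obtain ⟨⟨j, hj⟩, hxj⟩ := Set.mem_iUnion.1 h
    exact hmin j hxj hj
  have hadd : ∀ α, α ≤ γ → μ (⋃ i : Set.Iio α, E i) ∈
      Sg.sum ⟨α, fun i => μ (B i)⟩ := fun α hα => by
    have := hμ.additive α (hα.trans_lt hγ) (fun i => B i)
      (fun i => hBM _ (lt_of_lt_of_le i.2 hα))
      (fun i j hij => hdisj _ _ fun h => hij (Subtype.ext h))
    rwa [hunion] at this
  have hlub := Sg.sum_limit ⟨γ, fun i => μ (B i)⟩ hl _ (hadd γ le_rfl)
    fun β hβ => ⟨β, hβ, le_rfl, Part.dom_iff_mem.2 ⟨_, hadd β (le_of_lt hβ)⟩⟩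
  refine hlub.2 ?_
  rintro c ⟨α, hα, hc⟩
  rw [Part.mem_unique hc (hadd α (le_of_lt hα))]
  refine le_trans (hμ.mono _ (hM.iUnion_Iio_mem (lt_trans hα hγ) E
    fun j hj => hE j (lt_trans hj hα)) _ (hE α hα) ?_) (hb α hα)
  exact Set.iUnion_subset fun i => hmono (le_of_lt i.2)

/-- The side set `C` is universally quantified so that a successor step can absorb the last set into
it. -/
theorem union_iUnion_Iio_le (hμ : IsLambdaMeasure lam M Sg μ) (hM : IsLambdaAlgebra lam M)
    (hlam : ℵ₀ < lam) {A : Ordinal.{u} → Set Y} (hA : ∀ i, A i ∈ M) {b : S} (γ : Ordinal.{u}) :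
    γ < (Order.succ lam).ord → ∀ C ∈ M,
      (∀ F : Finset Ordinal.{u}, (∀ i ∈ F, i < γ) → μ (C ∪ ⋃ i ∈ F, A i) ≤ b) →
      μ (C ∪ ⋃ i : Set.Iio γ, A i) ≤ b := by
  classical
  induction γ using Ordinal.limitRecOn with
  | zero =>
    intro _ C _ h
    have : IsEmpty (Set.Iio (0 : Ordinal.{u})) := by simp
    simpa using h ∅ (by simp)
  | add_one γ ih =>
    intro hγ C hC h
    have hlt : γ < γ + 1 := lt_add_one γ
    have key := ih (hlt.trans hγ) (C ∪ A γ) (hM.union_mem hlam hC (hA γ)) fun F hF => by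
      have := h (insert γ F) (by
        intro i hi
        rcases Finset.mem_insert.1 hi with rfl | hi
        exacts [hlt, (hF i hi).trans hlt])
      rwa [Finset.set_biUnion_insert, ← Set.union_assoc] at this
    convert key using 2
    ext x
    simp only [Set.mem_union, Set.mem_iUnion, Subtype.exists, Set.mem_Iio, Order.lt_add_one_iff,
      le_iff_lt_or_eq]
    grind
  | limit γ hl ih =>
    intro hγ C hC h
    have hmem : ∀ i < γ, C ∪ ⋃ j : Set.Iio i, A j ∈ M := fun i hi =>
      hM.union_mem hlam hC (hM.iUnion_Iio_mem (hi.trans hγ) A fun j _ => hA j)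
    have key := hμ.iUnion_le_of_isSuccLimit hM hlam hγ hl
      (E := fun i => C ∪ ⋃ j : Set.Iio i, A j) hmem
      (fun i j hij => Set.union_subset_union_right _ (Set.iUnion_subset fun k =>
        Set.subset_iUnion (fun k : Set.Iio j => A k) ⟨k, lt_of_lt_of_le k.2 hij⟩))
      (b := b) (fun i hi => ih i hi (hi.trans hγ) C hC fun F hF =>
        h F fun j hj => (hF j hj).trans hi)
    convert key using 2
    ext x
    simp only [Set.mem_union, Set.mem_iUnion, Subtype.exists, Set.mem_Iio]
    constructor
    · rintro (hx | ⟨i, hi, hx⟩)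
      · exact ⟨0, hl.bot_lt, Or.inl hx⟩
      · exact ⟨Order.succ i, hl.succ_lt hi, Or.inr ⟨i, Order.lt_succ i, hx⟩⟩
    · rintro ⟨i, hi, hx | ⟨j, hj, hx⟩⟩
      exacts [Or.inl hx, Or.inr ⟨j, hj.trans hi, hx⟩]

/-- The measure of a union of at most `lam` sets is the supremum of the measures of the unions of
finitely many of them. -/
theorem iUnion_le (hμ : IsLambdaMeasure lam M Sg μ) (hM : IsLambdaAlgebra lam M)
    (hlam : ℵ₀ < lam) {ι : Type u} (hι : #ι ≤ lam) {A : ι → Set Y} (hA : ∀ i, A i ∈ M) {b : S}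
    (h : ∀ F : Finset ι, μ (⋃ i ∈ F, A i) ≤ b) : μ (⋃ i, A i) ≤ b := by
  classical
  set o : Ordinal.{u} := (#ι).ord with ho
  have hoL : o < (Order.succ lam).ord := Cardinal.ord_lt_ord.2 (Order.lt_succ_of_le hι)
  obtain ⟨e⟩ : Nonempty (o.ToType ≃ ι) := Cardinal.eq.1 (by rw [Cardinal.mk_toType, card_ord])
  set e' : Set.Iio o ≃ ι := Ordinal.ToType.mk.toEquiv.trans e with he'
  -- The value `∅` from `o` on only makes the family total on ordinals.
  set A' : Ordinal.{u} → Set Y := fun i => if h : i < o then A (e' ⟨i, h⟩) else ∅ with hA'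
  have key := hμ.union_iUnion_Iio_le hM hlam (A := A')
    (fun i => by dsimp only [A']; split_ifs; exacts [hA _, hM.empty_mem]) (b := b) o hoL ∅
    hM.empty_mem fun F hF => by
      have := h (F.attach.image fun i => e' ⟨i.1, hF i.1 i.2⟩)
      convert this using 2
      ext x
      simp only [Set.mem_union, Set.mem_iUnion, Set.mem_empty_iff_false, false_or,
        Finset.mem_image, Finset.mem_attach, true_and, A']
      constructor
      · rintro ⟨i, hi, hx⟩
        rw [dif_pos (hF i hi)] at hx
        exact ⟨_, ⟨⟨i, hi⟩, rfl⟩, hx⟩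
      · rintro ⟨_, ⟨⟨i, hi⟩, rfl⟩, hx⟩
        exact ⟨i, hi, by rwa [dif_pos (hF i hi)]⟩
  convert key using 2
  rw [Set.empty_union, ← e'.surjective.iUnion_comp]
  refine Set.iUnion_congr fun i => ?_
  have hi : i.1 < o := i.2
  simp [A', hi]

/-- Point-regularity gives covers by at most `lam` sets of arbitrarily small measure. -/
theorem exists_cover_lt (hμ : IsLambdaMeasure lam M Sg μ) (hweight : topologicalWeight Y ≤ lam)
    (hopen : ∀ U : Set Y, IsOpen U → U ∈ M) (hcont : IsContinuousMeasure M μ) {d : S}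
    (hd : 0 < d) : ∃ (ι : Type u) (T : ι → Set Y), #ι ≤ lam ∧ (∀ i, T i ∈ M) ∧
      (∀ i, μ (T i) < d) ∧ ⋃ i, T i = Set.univ := by
  obtain ⟨B, hB, hBcard⟩ := exists_isTopologicalBasis_of_topologicalWeight_le hweight
  refine ⟨{U ∈ B | μ U < d}, fun U => U, (mk_le_mk_of_subset (Set.sep_subset _ _)).trans hBcard,
    fun U => hopen U (hB.isOpen U.2.1), fun U => U.2.2, Set.eq_univ_of_forall fun x => ?_⟩
  have hglb := hμ.point_regular x (hcont x).1 {U ∈ B | x ∈ U}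
    ⟨fun U hU => ⟨hB.isOpen hU.1, hU.2⟩, fun V hV hx => by
      obtain ⟨U, hU, hxU, hUV⟩ := hB.exists_subset_of_mem_open hx hV
      exact ⟨U, ⟨hU, hxU⟩, hUV⟩⟩ ((mk_le_mk_of_subset (Set.sep_subset _ _)).trans hBcard)
  rw [(hcont x).2] at hglb
  obtain ⟨_, ⟨U, hU, rfl⟩, hlt⟩ := (isGLB_lt_iff hglb).1 hd
  exact Set.mem_iUnion.2 ⟨⟨U, hU.1, hlt⟩, hU.2⟩

end IsLambdaMeasure

/-! ### Separation of points and monoid arithmetic -/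

/-- Points that a generating family does not separate are not separated by the algebra. -/
theorem generatedLambdaAlgebra_separates {Y : Type u} {lam : Cardinal.{u}} {G : Set (Set Y)}
    {x y : Y} (h : ∀ A ∈ G, x ∈ A ↔ y ∈ A) : ∀ A ∈ generatedLambdaAlgebra lam G, x ∈ A ↔ y ∈ A := by
  intro A hA
  -- The sets that do not distinguish `x` from `y` form an algebra.
  refine Set.mem_sInter.1 hA {A | x ∈ A ↔ y ∈ A} ⟨⟨fun T hT _ => ?_, fun T hT _ => ?_, ?_⟩, h⟩
  · exact exists_congr fun t => and_congr_right fun ht => hT ht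
  · exact forall_congr' fun t => imp_congr_right fun ht => hT ht
  · exact fun B hB => not_congr hB

namespace IsPositivelyOrderedMonoid

variable {S : Type v} [AddMonoid S] [LinearOrder S] [IsPositivelyOrderedMonoid S]

theorem nonpos_iff {a : S} : a ≤ 0 ↔ a = 0 :=
  ⟨fun h => le_antisymm h (zero_le a), fun h => h.le⟩

theorem pos_iff {a : S} : 0 < a ↔ a ≠ 0 := by
  rw [← not_le, nonpos_iff]

theorem nsmul_mono_right {a b : S} (n : ℕ) (h : a ≤ b) : n • a ≤ n • b := by
  induction n with
  | zero => simp
  | succ n ih => simpa [succ_nsmul] using add_le_add _ _ _ _ ih h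

end IsPositivelyOrderedMonoid

open IsPositivelyOrderedMonoid (zero_le nonpos_iff pos_iff nsmul_mono_right)

/-! ### Null sets, absence of atoms, coinitiality, countable covers -/

namespace IsLambdaMeasure

variable {Y : Type u} [TopologicalSpace Y] {lam : Cardinal.{u}} {M : Set (Set Y)}
  {S : Type v} [AddMonoid S] [LinearOrder S]
  {Sg : InfinitarySum.{u, v} S} {μ : Set Y → S}

theorem inter_add_diff (hμ : IsLambdaMeasure lam M Sg μ) (hM : IsLambdaAlgebra lam M)
    (hlam : ℵ₀ < lam) {A B : Set Y} (hA : A ∈ M) (hB : B ∈ M) :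
    μ (A ∩ B) + μ (A \ B) = μ A := by
  rw [← hμ.union_eq hlam (hM.inter_mem hlam hA hB) (hM.diff_mem hlam hA hB)
    (Set.disjoint_sdiff_right.mono_left Set.inter_subset_right), Set.inter_union_sdiff]

variable [IsPositivelyOrderedMonoid S]

theorem union_le_add (hμ : IsLambdaMeasure lam M Sg μ) (hM : IsLambdaAlgebra lam M)
    (hlam : ℵ₀ < lam) {A B : Set Y} (hA : A ∈ M) (hB : B ∈ M) : μ (A ∪ B) ≤ μ A + μ B := by
  rw [← Set.union_sdiff_self, hμ.union_eq hlam hA (hM.diff_mem hlam hB hA) Set.disjoint_sdiff_right]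
  exact IsPositivelyOrderedMonoid.add_le_add _ _ _ _ le_rfl
    (hμ.mono _ (hM.diff_mem hlam hB hA) _ hB Set.sdiff_subset)

theorem finset_biUnion_le (hμ : IsLambdaMeasure lam M Sg μ) (hM : IsLambdaAlgebra lam M)
    (hlam : ℵ₀ < lam) {ι : Type*} {A : ι → Set Y} (hA : ∀ i, A i ∈ M) {d : S}
    (hd : ∀ i, μ (A i) ≤ d) (F : Finset ι) : μ (⋃ i ∈ F, A i) ≤ F.card • d := by
  classical
  induction F using Finset.induction_on with
  | empty => simp [hμ.empty]
  | insert a s ha ih =>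
    rw [Finset.set_biUnion_insert, Set.union_comm, Finset.card_insert_of_notMem ha, succ_nsmul]
    exact (hμ.union_le_add hM hlam (hM.finset_biUnion_mem hlam s A fun i _ => hA i) (hA a)).trans
      (IsPositivelyOrderedMonoid.add_le_add _ _ _ _ ih (hd a))

theorem le_finset_biUnion (hμ : IsLambdaMeasure lam M Sg μ) (hM : IsLambdaAlgebra lam M)
    (hlam : ℵ₀ < lam) {ι : Type*} {A : ι → Set Y} (hA : ∀ i, A i ∈ M)
    (hdisj : Pairwise (Function.onFun Disjoint A)) {d : S} (F : Finset ι)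
    (hd : ∀ i ∈ F, d ≤ μ (A i)) : F.card • d ≤ μ (⋃ i ∈ F, A i) := by
  classical
  induction F using Finset.induction_on with
  | empty => simp [hμ.empty]
  | insert a s ha ih =>
    rw [Finset.set_biUnion_insert, Set.union_comm, Finset.card_insert_of_notMem ha, succ_nsmul,
      hμ.union_eq hlam (hM.finset_biUnion_mem hlam s A fun i _ => hA i) (hA a)]
    · exact IsPositivelyOrderedMonoid.add_le_add _ _ _ _
        (ih fun i hi => hd i (by simp [hi])) (hd a (by simp))
    · simp only [Set.disjoint_iUnion_left]
      exact fun i hi => hdisj fun h => ha (h ▸ hi)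

theorem iUnion_eq_zero (hμ : IsLambdaMeasure lam M Sg μ) (hM : IsLambdaAlgebra lam M)
    (hlam : ℵ₀ < lam) {ι : Type u} (hι : #ι ≤ lam) {A : ι → Set Y} (hA : ∀ i, A i ∈ M)
    (h : ∀ i, μ (A i) = 0) : μ (⋃ i, A i) = 0 :=
  nonpos_iff.1 <| hμ.iUnion_le hM hlam hι hA fun F =>
    (hμ.finset_biUnion_le hM hlam hA (fun i => (h i).le) F).trans (by simp)

theorem union_eq_zero (hμ : IsLambdaMeasure lam M Sg μ) (hM : IsLambdaAlgebra lam M)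
    (hlam : ℵ₀ < lam) {A B : Set Y} (hA : A ∈ M) (hB : B ∈ M) (hA0 : μ A = 0) (hB0 : μ B = 0) :
    μ (A ∪ B) = 0 :=
  nonpos_iff.1 <| (hμ.union_le_add hM hlam hA hB).trans (by simp [hA0, hB0])

/-- A continuous measure on a `lam⁺`-Borel space has no atoms. -/
theorem exists_inter_diff_pos (hμ : IsLambdaMeasure lam M Sg μ) (hM : IsLambdaBorelSpace lam M)
    (hlam : ℵ₀ < lam) (hcont : IsContinuousMeasure M μ) {V : Set Y} (hV : V ∈ M)
    (hpos : 0 < μ V) : ∃ B ∈ M, 0 < μ (V ∩ B) ∧ 0 < μ (V \ B) := by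
  classical
  by_contra! hcon
  have hA := hM.isLambdaAlgebra
  obtain ⟨G, hGcard, hMG⟩ := hM.generated
  have hGM : G ⊆ M := by
    rw [hMG]
    exact Set.subset_sInter fun N hN => hN.2
  -- If `V` were an atom, each generator would cut it into two halves, one of them null; `g` picks a
  -- null one. Outside all of these no generator separates points of `V`, so at most one point
  -- remains.
  set g : G → Set Y := fun A => if μ (V ∩ A) = 0 then V ∩ A else V \ A with hg
  have hgM : ∀ A, g A ∈ M := fun A => by
    dsimp only [g]
    split_ifs
    exacts [hA.inter_mem hlam hV (hGM A.2), hA.diff_mem hlam hV (hGM A.2)]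
  have hg0 : ∀ A, μ (g A) = 0 := fun A => by
    dsimp only [g]
    split_ifs with h
    exacts [h, nonpos_iff.1 (hcon A (hGM A.2) (pos_iff.2 h))]
  have hUM := hA.iUnion_mem hGcard g hgM
  have hU0 := hμ.iUnion_eq_zero hA hlam hGcard hgM hg0
  have hsub : (V \ ⋃ A, g A).Subsingleton := by
    intro x hx y hy
    by_contra hxy
    obtain ⟨A, hAM, hne⟩ := hM.separates x y hxy
    refine hne (generatedLambdaAlgebra_separates (fun B hB => ?_) A (hMG ▸ hAM))
    have hx' : x ∉ g ⟨B, hB⟩ := fun h => hx.2 (Set.mem_iUnion_of_mem _ h)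
    have hy' : y ∉ g ⟨B, hB⟩ := fun h => hy.2 (Set.mem_iUnion_of_mem _ h)
    have hxV := hx.1
    have hyV := hy.1
    dsimp only [g] at hx' hy'
    split_ifs at hx' hy' <;> simp_all
  have hd0 : μ (V \ ⋃ A, g A) = 0 := by
    rcases hsub.eq_empty_or_singleton with h | ⟨x, h⟩
    · rw [h, hμ.empty]
    · rw [h, (hcont x).2]
  have h := hμ.inter_add_diff hA hlam hV hUM
  rw [hd0, add_zero] at h
  have h' := hμ.mono _ (hA.inter_mem hlam hV hUM) _ hUM Set.inter_subset_right
  rw [h, hU0] at h'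
  exact absurd hpos (not_lt.2 h')

/-- Split off a positive piece, recurse in the other, and take the smaller bound. -/
theorem exists_nsmul_le (hμ : IsLambdaMeasure lam M Sg μ) (hM : IsLambdaBorelSpace lam M)
    (hlam : ℵ₀ < lam) (hcont : IsContinuousMeasure M μ) (n : ℕ) :
    ∀ V ∈ M, 0 < μ V → ∃ d : S, 0 < d ∧ n • d ≤ μ V := by
  induction n with
  | zero => exact fun V _ hV => ⟨_, hV, by simpa using zero_le _⟩
  | succ n ih =>
    intro V hV hpos
    obtain ⟨B, hB, h1, h2⟩ := hμ.exists_inter_diff_pos hM hlam hcont hV hpos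
    obtain ⟨d, hd, hle⟩ := ih _ (hM.isLambdaAlgebra.inter_mem hlam hV hB) h1
    refine ⟨min d (μ (V \ B)), lt_min hd h2, ?_⟩
    rw [← hμ.inter_add_diff hM.isLambdaAlgebra hlam hV hB, succ_nsmul]
    exact IsPositivelyOrderedMonoid.add_le_add _ _ _ _
      ((nsmul_mono_right n (min_le_left _ _)).trans hle) (min_le_right _ _)

/-- Otherwise `c` bounds all finite unions from a cover by sets smaller than `d`, hence bounds μ(Y).
This Archimedean property reaches only values strictly below μ(Y), which is why later arguments work
inside a set of less than full measure. -/
theorem exists_lt_nsmul (hμ : IsLambdaMeasure lam M Sg μ) (hM : IsLambdaAlgebra lam M)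
    (hlam : ℵ₀ < lam) (hweight : topologicalWeight Y ≤ lam)
    (hopen : ∀ U : Set Y, IsOpen U → U ∈ M) (hcont : IsContinuousMeasure M μ) {c d : S}
    (hd : 0 < d) (hc : c < μ Set.univ) : ∃ n : ℕ, c < n • d := by
  by_contra! h
  obtain ⟨ι, T, hT, hTM, hTd, hTU⟩ := hμ.exists_cover_lt hweight hopen hcont hd
  refine absurd hc (not_lt.2 ?_)
  rw [← hTU]
  exact hμ.iUnion_le hM hlam hT hTM fun F =>
    (hμ.finset_biUnion_le hM hlam hTM (fun i => (hTd i).le) F).trans (h _)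

/-- Otherwise the members of a cover by sets smaller than `d` are all null, and so is Y. -/
theorem exists_pos_lt (hμ : IsLambdaMeasure lam M Sg μ) (hM : IsLambdaAlgebra lam M)
    (hlam : ℵ₀ < lam) (hweight : topologicalWeight Y ≤ lam)
    (hopen : ∀ U : Set Y, IsOpen U → U ∈ M) (hcont : IsContinuousMeasure M μ) {d : S}
    (hd : 0 < d) : ∃ V ∈ M, 0 < μ V ∧ μ V < d := by
  by_contra! h
  obtain ⟨ι, T, hT, hTM, hTd, hTU⟩ := hμ.exists_cover_lt hweight hopen hcont hd
  refine absurd hμ.univ_pos (not_lt.2 ?_)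
  rw [← hTU, hμ.iUnion_eq_zero hM hlam hT hTM fun i => ?_]
  by_contra h0
  exact absurd (hTd i) (not_lt.2 (h _ (hTM i) (pos_iff.2 h0)))

/-- The positive elements of the monoid have countable coinitiality. -/
theorem exists_seq_coinitial (hμ : IsLambdaMeasure lam M Sg μ) (hM : IsLambdaBorelSpace lam M)
    (hlam : ℵ₀ < lam) (hweight : topologicalWeight Y ≤ lam)
    (hopen : ∀ U : Set Y, IsOpen U → U ∈ M) (hcont : IsContinuousMeasure M μ) :
    ∃ d : ℕ → S, (∀ n, 0 < d n) ∧ ∀ e : S, 0 < e → ∃ n, d n < e := by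
  have hA := hM.isLambdaAlgebra
  obtain ⟨V, hV, hpos, hlt⟩ := hμ.exists_pos_lt hA hlam hweight hopen hcont hμ.univ_pos
  choose d hd hle using fun n : ℕ => hμ.exists_nsmul_le hM hlam hcont n V hV hpos
  refine ⟨d, hd, fun e he => ?_⟩
  -- If `e ≤ d n`, then μ(V) < n • e ≤ n • d n ≤ μ(V).
  obtain ⟨n, hn⟩ := hμ.exists_lt_nsmul hA hlam hweight hopen hcont he hlt
  refine ⟨n, not_le.1 fun h => ?_⟩
  exact absurd ((hn.trans_le (nsmul_mono_right n h)).trans_le (hle n)) (lt_irrefl _)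

/-- A disjoint family of sets inside a set of less than full measure has only countably many
members of positive measure. -/
theorem countable_pos (hμ : IsLambdaMeasure lam M Sg μ) (hM : IsLambdaBorelSpace lam M)
    (hlam : ℵ₀ < lam) (hweight : topologicalWeight Y ≤ lam)
    (hopen : ∀ U : Set Y, IsOpen U → U ∈ M) (hcont : IsContinuousMeasure M μ) {U : Set Y}
    (hU : U ∈ M) (hlt : μ U < μ Set.univ) {ι : Type*} {A : ι → Set Y} (hA : ∀ i, A i ∈ M)
    (hAU : ∀ i, A i ⊆ U) (hdisj : Pairwise (Function.onFun Disjoint A)) :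
    {i | 0 < μ (A i)}.Countable := by
  obtain ⟨d, hd, hco⟩ := hμ.exists_seq_coinitial hM hlam hweight hopen hcont
  have hsub : {i | 0 < μ (A i)} ⊆ ⋃ n, {i | d n ≤ μ (A i)} := fun i hi => by
    obtain ⟨n, hn⟩ := hco _ hi
    exact Set.mem_iUnion.2 ⟨n, hn.le⟩
  refine (Set.countable_iUnion fun n => Set.Finite.countable ?_).mono hsub
  by_contra hinf
  -- With `k • d n` above μ(U), no `k` disjoint subsets of `U` can each have measure at least `d n`.
  obtain ⟨k, hk⟩ := hμ.exists_lt_nsmul hM.isLambdaAlgebra hlam hweight hopen hcont (hd n) hlt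
  obtain ⟨F, hF, hFk⟩ := Set.Infinite.exists_subset_card_eq hinf k
  have h := hμ.le_finset_biUnion hM.isLambdaAlgebra hlam hA hdisj F fun i hi => hF hi
  rw [hFk] at h
  exact absurd (hk.trans_le (h.trans (hμ.mono _ (hM.isLambdaAlgebra.finset_biUnion_mem hlam F A
    fun i _ => hA i) U hU (Set.iUnion₂_subset fun i _ => hAU i)))) (lt_irrefl _)

/-- A set of less than full measure is covered, up to a null set, by countably many sets of
arbitrarily small measure. -/
theorem exists_seq_cover_lt (hμ : IsLambdaMeasure lam M Sg μ) (hM : IsLambdaBorelSpace lam M)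
    (hlam : ℵ₀ < lam) (hweight : topologicalWeight Y ≤ lam)
    (hopen : ∀ U : Set Y, IsOpen U → U ∈ M) (hcont : IsContinuousMeasure M μ) {U : Set Y}
    (hU : U ∈ M) (hlt : μ U < μ Set.univ) {d : S} (hd : 0 < d) :
    ∃ f : ℕ → Set Y, (∀ n, f n ∈ M) ∧ (∀ n, μ (f n) < d) ∧
      ∃ Z ∈ M, μ Z = 0 ∧ U ⊆ Z ∪ ⋃ n, f n := by
  have hA := hM.isLambdaAlgebra
  obtain ⟨ι, T, hT, hTM, hTd, hTU⟩ := hμ.exists_cover_lt hweight hopen hcont hd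
  obtain ⟨_, hwf⟩ := exists_wellFoundedLT ι
  set D : ι → Set Y := fun t => (U ∩ T t) \ ⋃ s ∈ Set.Iio t, T s with hD
  have hDM : ∀ t, D t ∈ M := fun t =>
    hA.diff_mem hlam (hA.inter_mem hlam hU (hTM t))
      (hA.biUnion_mem _ ((mk_set_le _).trans hT) _ fun s _ => hTM s)
  have hDdisj : Pairwise (Function.onFun Disjoint D) := by
    have h : ∀ s t, s < t → Disjoint (D s) (D t) := fun s t hst =>
      Set.disjoint_left.2 fun x hx hx' => hx'.2 (Set.mem_iUnion₂.2 ⟨s, hst, hx.1.2⟩)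
    intro s t hst
    rcases lt_or_gt_of_ne hst with h' | h'
    exacts [h s t h', (h t s h').symm]
  have hcov : U ⊆ ⋃ t, D t := fun x hx => by
    obtain ⟨t, ht, hmin⟩ := WellFounded.has_min (wellFounded_lt (α := ι)) {t | x ∈ T t}
      (Set.mem_iUnion.1 (hTU ▸ Set.mem_univ x))
    refine Set.mem_iUnion.2 ⟨t, ⟨hx, ht⟩, fun h => ?_⟩
    obtain ⟨s, hs, hxs⟩ := Set.mem_iUnion₂.1 h
    exact hmin s hxs hs
  have hcount := hμ.countable_pos hM hlam hweight hopen hcont hU hlt hDM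
    (fun t x hx => hx.1.1) hDdisj
  have hDd : ∀ t, μ (D t) < d := fun t =>
    (hμ.mono _ (hDM t) _ (hTM t) fun x hx => hx.1.2).trans_lt (hTd t)
  -- Inserting `∅` keeps the family nonempty, so that ℕ enumerates it.
  obtain ⟨f, hf⟩ := ((hcount.image D).insert ∅).exists_eq_range (Set.insert_nonempty _ _)
  have hfmem : ∀ n, f n ∈ insert ∅ (D '' {i | 0 < μ (D i)}) := fun n => hf ▸ Set.mem_range_self n
  refine ⟨f, fun n => ?_, fun n => ?_, ⋃ t : {t | ¬ 0 < μ (D t)}, D t,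
    hA.iUnion_mem ((mk_set_le _).trans hT) _ fun t => hDM t,
    hμ.iUnion_eq_zero hA hlam ((mk_set_le _).trans hT) (fun t => hDM t)
      fun t => nonpos_iff.1 (not_lt.1 t.2), fun x hx => ?_⟩
  · rcases hfmem n with h | ⟨t, -, h⟩
    exacts [h ▸ hA.empty_mem, h ▸ hDM t]
  · rcases hfmem n with h | ⟨t, -, h⟩
    exacts [by rwa [h, hμ.empty], h ▸ hDd t]
  · obtain ⟨t, ht⟩ := Set.mem_iUnion.1 (hcov hx)
    by_cases h : 0 < μ (D t)
    · obtain ⟨n, hn⟩ : D t ∈ Set.range f := hf ▸ Or.inr ⟨t, h, rfl⟩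
      exact Or.inr (Set.mem_iUnion.2 ⟨n, hn ▸ ht⟩)
    · exact Or.inl (Set.mem_iUnion.2 ⟨⟨t, h⟩, ht⟩)

end IsLambdaMeasure

/-! ### The contradiction by distributing intersections over unions -/

theorem mainTheorem3 (lam : Cardinal.{u}) (hlam : ℵ₀ < lam) (hpow : (2 : Cardinal.{u}) ^< lam = lam)
    {Y : Type u} (M : Set (Set Y)) (hM : IsLambdaBorelSpace lam M)
    [TopologicalSpace Y] (hweight : topologicalWeight Y ≤ lam)
    (hopen : ∀ U : Set Y, IsOpen U → U ∈ M)
    {S : Type v} [AddMonoid S] [LinearOrder S] [IsPositivelyOrderedMonoid S]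
    (Sg : InfinitarySum.{u, v} S) :
    ¬ ∃ μ : Set Y → S, IsLambdaMeasure lam M Sg μ ∧ IsContinuousMeasure M μ := by
  rintro ⟨μ, hμ, hcont⟩
  have hA := hM.isLambdaAlgebra
  have hN : #(ULift.{u} ℕ) ≤ lam := by simpa using hlam.le
  have hNN : #(ULift.{u} (ℕ → ℕ)) ≤ lam := by
    -- The cardinal hypothesis enters here: the choice functions ℕ → ℕ index a union of admissible
    -- size.
    have h : (2 : Cardinal.{u}) ^ ℵ₀ ≤ lam := (le_powerlt 2 hlam).trans_eq hpow
    simpa using h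
  obtain ⟨U, hU, hpos, hlt⟩ := hμ.exists_pos_lt hA hlam hweight hopen hcont hμ.univ_pos
  obtain ⟨d, hd, hco⟩ := hμ.exists_seq_coinitial hM hlam hweight hopen hcont
  choose f hfM hfd Z hZM hZ0 hcov using fun n : ℕ =>
    hμ.exists_seq_cover_lt hM hlam hweight hopen hcont hU hlt (hd n)
  have hIM : ∀ g : ULift.{u} (ℕ → ℕ), (⋂ n : ULift.{u} ℕ, f n.down (g.down n.down)) ∈ M :=
    fun g => hA.iInter_mem hN _ fun n => hfM _ _
  have hI0 : ∀ g : ULift.{u} (ℕ → ℕ), μ (⋂ n : ULift.{u} ℕ, f n.down (g.down n.down)) = 0 := by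
    intro g
    by_contra h0
    obtain ⟨n, hn⟩ := hco _ (pos_iff.2 h0)
    exact absurd ((hμ.mono _ (hIM g) _ (hfM n (g.down n))
      (Set.iInter_subset _ (ULift.up n))).trans_lt (hfd n _)) (not_lt.2 hn.le)
  have hZ : (⋃ n : ULift.{u} ℕ, Z n.down) ∈ M := hA.iUnion_mem hN _ fun n => hZM _
  have hI := hA.iUnion_mem hNN _ hIM
  have hle := hμ.mono U hU _ (hA.union_mem hlam hZ hI) fun x hx => by
    by_cases hxZ : ∃ n, x ∈ Z n
    · obtain ⟨n, hn⟩ := hxZ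
      exact Or.inl (Set.mem_iUnion.2 ⟨⟨n⟩, hn⟩)
    · push Not at hxZ
      -- A point outside every `Z n` selects at each level a piece containing it, and so lies in the
      -- intersection along `g`.
      choose g hg using fun n => Set.mem_iUnion.1 ((hcov n hx).resolve_left (hxZ n))
      exact Or.inr (Set.mem_iUnion.2 ⟨⟨g⟩, Set.mem_iInter.2 fun n => hg n.down⟩)
  rw [hμ.union_eq_zero hA hlam hZ hI (hμ.iUnion_eq_zero hA hlam hN (fun n => hZM _) fun n => hZ0 _)
    (hμ.iUnion_eq_zero hA hlam hNN hIM hI0)] at hle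
  exact absurd hpos (not_lt.2 hle)
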